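/- Let $(M^{2n},d\lambda)$ be an exact symplectic manifold (for instance one that is tame at infinity), that is, $M$ is a smooth $2n$-dimensional manifold without boundary (Hausdorff and second countable) and $\lambda$ is a smooth $1$-form on $M$ with $d\lambda$ nondegenerate. Assume that the Liouville vector field $X$, given by $i_X d\lambda=\lambda$, is complete, and let $\{\psi_t\}_{t\in\mathbb R}$ be its (smooth, globally defined) flow, the Liouville flow. A closed exact Lagrangian submanifold of $(M,d\lambda)$ is a compact embedded $n$-dimensional submanifold $L\subset M$ without boundary with $d\lambda|_L=0$ and $\lambda|_L=df$ for some $f\in C^\infty(L)$. Given two of them, $L_-$ and $L_+$, an exact Lagrangian cobordism $V\colon L_+\rightsquigarrow L_-$ is an embedded exact Lagrangian submanifold $V$ without boundary of $(\mathbb R^2(x,y)\times M,\ d(x\,dy\oplus\lambda))$ for which there is $R>0$ such that $$V\cap\{x\le -R\}=((-\infty,-R]\times\{0\})\times L_-,\qquad V\cap\{x\ge R\}=([R,\infty)\times\{0\})\times L_+,$$ and $V\cap([-R,R]\times\mathbb R\times M)$ is compact. Let $\pi\colon\mathbb R^2\times M\to\mathbb R^2$ be the projection. The outline $ou(V)\subset\mathbb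 R^2$ is the complement of the union of all unbounded connected components of $\mathbb R^2\setminus\pi(V)$, and the shadow $\mathcal S(V)$ is the area of $ou(V)$. For a closed exact Lagrangian submanifold $L$ let $\mathcal L(L)$ be the set of all closed exact Lagrangian submanifolds $L'$ for which there is an exact Lagrangian cobordism $L'\rightsquigarrow L$, and put $$d_c(L',L''):=\inf\{\mathcal S(V)\mid V\colon L''\rightsquigarrow L'\text{ is an exact Lagrangian cobordism}\}.$$ **Proposition.** Fix $t\in\mathbb R$ and a closed exact Lagrangian submanifold $L\subset(M,d\lambda)$. Then $\psi_t(L)$ is a closed exact Lagrangian submanifold, and for every $L'\in\mathcal L(L)$ we have $\psi_t(L')\in\mathcal L(\psi_t(L))$, $d_c(L,L')<\infty$, and $$d_c(\psi_t(L),\psi_t(L'))=e^t\,d_c(L,L').$$ -/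

import Mathlib

open scoped Manifold ContDiff Topology ENNReal
open MeasureTheory

noncomputable section

namespace LagCob

section Forms

variable {E : Type*} [NormedAddCommGroup E] [NormedSpace ℝ E]
  {H : Type*} [TopologicalSpace H] {I : ModelWithCorners ℝ E H}
  {W : Type*} [TopologicalSpace W] [ChartedSpace H W]
  {E' : Type*} [NormedAddCommGroup E'] [NormedSpace ℝ E']
  {H' : Type*} [TopologicalSpace H'] {I' : ModelWithCorners ℝ E' H'}
  {W' : Type*} [TopologicalSpace W'] [ChartedSpace H' W']

/-- A (not necessarily smooth) differential `1`-form on the manifold `W`. -/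
abbrev OneForm (I : ModelWithCorners ℝ E H) (W : Type*) [TopologicalSpace W]
    [ChartedSpace H W] : Type _ :=
  (x : W) → (TangentSpace I x →L[ℝ] ℝ)

/-- A `1`-form is smooth if it is a smooth section of the cotangent bundle. -/
def OneForm.IsSmooth [IsManifold I ∞ W] (α : OneForm I W) : Prop :=
  ContMDiff I (I.prod 𝓘(ℝ, E →L[ℝ] ℝ)) ∞
    (fun x : W => Bundle.TotalSpace.mk' (E →L[ℝ] ℝ)
      (E := fun x : W => TangentSpace I x →L[ℝ] Bundle.Trivial W ℝ x) x (α x))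

/-- The pullback `f^* α` of a `1`-form. -/
def OneForm.pullback (I : ModelWithCorners ℝ E H) (f : W → W') (α : OneForm I' W') :
    OneForm I W :=
  fun x => (α (f x)).comp (mfderiv I I' f x)

/-- The `1`-form `α` written in the preferred chart at `x₀`, that is, its pullback under the
inverse of the chart, as an alternating-map-valued function on the model vector space. -/
def OneForm.inChart (α : OneForm I W) (x₀ : W) : E → E [⋀^Fin 1]→L[ℝ] ℝ :=
  fun y => ContinuousAlternatingMap.ofSubsingleton ℝ E ℝ (0 : Fin 1)
    ((α ((extChartAt I x₀).symm y)).comp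
      (mfderivWithin 𝓘(ℝ, E) I (extChartAt I x₀).symm (Set.range I) y))

/-- The exterior derivative `dα` of a `1`-form, as a function of two tangent vectors at `x`:
it is computed in the preferred chart at `x`. The normalisation is
`dα(X, Y) = X(α(Y)) - Y(α(X)) - α([X, Y])`. -/
def OneForm.d (α : OneForm I W) (x : W) (u v : TangentSpace I x) : ℝ :=
  extDerivWithin (α.inChart x) (Set.range I) (extChartAt I x x)
    ![mfderiv I 𝓘(ℝ, E) (extChartAt I x) x u, mfderiv I 𝓘(ℝ, E) (extChartAt I x) x v]

/-- `(W, dα)` is an exact symplectic manifold: `α` is smooth and `dα` is nondegenerate. -/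
structure IsExactSymplectic [IsManifold I ∞ W] (α : OneForm I W) : Prop where
  smooth : α.IsSmooth
  nondegenerate : ∀ (x : W) (u : TangentSpace I x), (∀ v : TangentSpace I x, α.d x u v = 0) → u = 0

/-- `X` is the Liouville vector field of `(W, dα)`: `i_X dα = α`. -/
def IsLiouvilleField (α : OneForm I W) (X : (x : W) → TangentSpace I x) : Prop :=
  ∀ (x : W) (v : TangentSpace I x), α.d x (X x) v = α x v

/-- `ψ` is the globally defined (smooth) flow of the Liouville vector field of `(W, dα)`. -/
structure IsLiouvilleFlow (α : OneForm I W) (ψ : ℝ → W → W) : Prop where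
  smooth : ContMDiff (𝓘(ℝ, ℝ).prod I) I ∞ (fun p : ℝ × W => ψ p.1 p.2)
  zero : ∀ x : W, ψ 0 x = x
  integralCurve : ∃ X : (x : W) → TangentSpace I x, IsLiouvilleField α X ∧
    ∀ x : W, IsMIntegralCurve (I := I) (fun t : ℝ => ψ t x) X

/-- With respect to the given smooth structure on the subset `V` (with its subspace topology),
`V` is a `k`-dimensional embedded submanifold of `W` which is Lagrangian for `dα`
and exact: `α|_V = df` for a smooth function `f` on `V`. -/
structure ExactLagrangianStructure (α : OneForm I W) (k : ℕ) (V : Set W)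
    [ChartedSpace (EuclideanSpace ℝ (Fin k)) V] : Prop where
  half_dim : 2 * k = Module.finrank ℝ E
  isManifold : IsManifold (𝓡 k) ∞ V
  embedding : Manifold.IsSmoothEmbedding (𝓡 k) I ∞ (Subtype.val : V → W)
  isotropic : ∀ (p : V) (u v : TangentSpace (𝓡 k) p),
    α.d (p : W) (mfderiv (𝓡 k) I (Subtype.val : V → W) p u)
      (mfderiv (𝓡 k) I (Subtype.val : V → W) p v) = 0
  exact : ∃ f : V → ℝ, ContMDiff (𝓡 k) 𝓘(ℝ, ℝ) ∞ f ∧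
    ∀ p : V, OneForm.pullback (𝓡 k) (Subtype.val : V → W) α p = mfderiv (𝓡 k) 𝓘(ℝ, ℝ) f p

/-- `V` is a `k`-dimensional embedded exact Lagrangian submanifold (without boundary)
of the exact symplectic manifold `(W, dα)`. -/
def IsExactLagrangian (α : OneForm I W) (k : ℕ) (V : Set W) : Prop :=
  ∃ _ : ChartedSpace (EuclideanSpace ℝ (Fin k)) V, ExactLagrangianStructure α k V

end Forms

/-- The `1`-form `x dy` on the plane. -/
def planeForm : OneForm 𝓘(ℝ, ℝ × ℝ) (ℝ × ℝ) :=
  fun z => z.1 • ContinuousLinearMap.snd ℝ ℝ ℝ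

/-- The union of all unbounded connected components of the complement of `S`. -/
def unboundedPart (S : Set (ℝ × ℝ)) : Set (ℝ × ℝ) :=
  ⋃₀ {C | ∃ z ∈ Sᶜ, C = connectedComponentIn Sᶜ z ∧ ¬ Bornology.IsBounded C}

/-- The outline of a subset `V` of `ℝ² × M`: the complement of the union of all unbounded
connected components of the complement of the projection of `V` to the plane. -/
def outline {M : Type*} (V : Set ((ℝ × ℝ) × M)) : Set (ℝ × ℝ) :=
  (unboundedPart (Prod.fst '' V))ᶜ

/-- The shadow: the area (Lebesgue measure) of the outline. -/
def shadow {M : Type*} (V : Set ((ℝ × ℝ) × M)) : ℝ≥0∞ :=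
  volume (outline V)

section Cobordism

variable {n : ℕ} {M : Type*} [TopologicalSpace M]
  [ChartedSpace (EuclideanSpace ℝ (Fin (2 * n))) M]

/-- The `1`-form `x dy ⊕ lam` on `ℝ² × M`. -/
def stabilize (lam : OneForm (𝓡 (2 * n)) M) :
    OneForm (𝓘(ℝ, ℝ × ℝ).prod (𝓡 (2 * n))) ((ℝ × ℝ) × M) :=
  fun q => OneForm.pullback (𝓘(ℝ, ℝ × ℝ).prod (𝓡 (2 * n))) Prod.fst planeForm q +
    OneForm.pullback (𝓘(ℝ, ℝ × ℝ).prod (𝓡 (2 * n))) Prod.snd lam q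

/-- `L` is a closed (that is, compact and without boundary) exact Lagrangian submanifold
of `(M, d lam)`. -/
def IsClosedExactLagrangian (lam : OneForm (𝓡 (2 * n)) M) (L : Set M) : Prop :=
  IsCompact L ∧ IsExactLagrangian lam n L

/-- `V : Lpos ⇝ Lneg` is an exact Lagrangian cobordism in `ℝ² × M`
with negative end `Lneg` and positive end `Lpos`. -/
structure IsExactCobordism (lam : OneForm (𝓡 (2 * n)) M) (V : Set ((ℝ × ℝ) × M))
    (Lpos Lneg : Set M) : Prop where
  exactLagrangian : IsExactLagrangian (stabilize lam) (n + 1) V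
  ends : ∃ R : ℝ, 0 < R ∧
    V ∩ {q | q.1.1 ≤ -R} = (Set.Iic (-R) ×ˢ {(0 : ℝ)}) ×ˢ Lneg ∧
    V ∩ {q | R ≤ q.1.1} = (Set.Ici R ×ˢ {(0 : ℝ)}) ×ˢ Lpos ∧
    IsCompact (((Set.Icc (-R) R ×ˢ (Set.univ : Set ℝ)) ×ˢ (Set.univ : Set M)) ∩ V)

/-- The space `𝓛(L)` of all closed exact Lagrangian submanifolds of `(M, d lam)` which are
exact Lagrangian cobordant to `L`. -/
def cobordantSpace (lam : OneForm (𝓡 (2 * n)) M) (L : Set M) : Set (Set M) :=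
  {L' | IsClosedExactLagrangian lam L' ∧ ∃ V, IsExactCobordism lam V L' L}

/-- The cobordism metric `d_c(L', L'')`: the infimum of the shadows of all exact Lagrangian
cobordisms `V : L'' ⇝ L'`. -/
def dc (lam : OneForm (𝓡 (2 * n)) M) (L' L'' : Set M) : ℝ≥0∞ :=
  sInf {a | ∃ V, IsExactCobordism lam V L'' L' ∧ a = shadow V}

end Cobordism

end LagCob

end

/-!
The Liouville flow rescales the Liouville form, `ψₜ^* λ = e^t λ`
(`LagCob.IsLiouvilleFlow.pullback_eq`). Indeed `λ(X) = dλ(X, X) = 0` for the Liouville field `X`,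
so Cartan's formula gives `L_X λ = i_X dλ = λ`. In the proof Cartan's formula is replaced by its
special case on `ℝ × E`, applied to the pullback of `λ` by the flow: if `β(∂ₜ) = 0`, then
`∂ₜ (β(v)) = dβ(∂ₜ, v)`. This uses that the exterior derivative commutes with pullback
(`LagCob.OneForm.d_pullback`), which is transferred from vector spaces to manifolds by charts.
Uniqueness of integral curves makes `ψ` a one-parameter group (`LagCob.IsLiouvilleFlow.add`), so
each `ψₜ` is a diffeomorphism with inverse `ψ₋ₜ`.

A diffeomorphism that multiplies the given `1`-form by a constant `c` carries exact Lagrangian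
submanifolds to exact Lagrangian submanifolds, the primitive being multiplied by `c`
(`LagCob.IsExactLagrangian.image`). This applies to `ψₜ` on `M`, and also to
`(x, y, p) ↦ (x, e^t y, ψₜ(p))` on `ℝ² × M`, which multiplies `x dy ⊕ λ` by `e^t`. The latter map
preserves the cylindrical ends, because they lie over the `x`-axis, and so it turns cobordisms
`L' ⇝ L` into cobordisms `ψₜ(L') ⇝ ψₜ(L)` (`LagCob.IsExactCobordism.image`). On the plane it induces
the linear map `(x, y) ↦ (x, e^t y)`, which commutes with forming the outline and multiplies areas by
`e^t` (`LagCob.shadow_image_stretch`). Taking infima gives `d_c(ψₜ(L), ψₜ(L')) ≤ e^t d_c(L, L')`, and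
the reverse inequality is the same statement for `ψ₋ₜ`.

Finally `d_c(L, L') < ∞` because every cobordism has finite shadow
(`LagCob.IsExactCobordism.shadow_ne_top`): its projection lies in the union of a square and the
`x`-axis, and from any point outside that union a vertical half-line leads to infinity.
-/

namespace LagCob

/-! ### Pullback and exterior derivative of one-forms -/

section Forms

variable {E : Type*} [NormedAddCommGroup E] [NormedSpace ℝ E]
  {H : Type*} [TopologicalSpace H] {I : ModelWithCorners ℝ E H}
  {W : Type*} [TopologicalSpace W] [ChartedSpace H W]
  {E' : Type*} [NormedAddCommGroup E'] [NormedSpace ℝ E']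
  {H' : Type*} [TopologicalSpace H'] {I' : ModelWithCorners ℝ E' H'}
  {W' : Type*} [TopologicalSpace W'] [ChartedSpace H' W']
  {E'' : Type*} [NormedAddCommGroup E''] [NormedSpace ℝ E'']
  {H'' : Type*} [TopologicalSpace H''] {I'' : ModelWithCorners ℝ E'' H''}
  {W'' : Type*} [TopologicalSpace W''] [ChartedSpace H'' W'']

/-- A `1`-form is regular at `x` if it is differentiable at `x` in the preferred chart at `x`. This
is all that is needed for its exterior derivative at `x` to be meaningful. -/
def OneForm.IsRegularAt (α : OneForm I W) (x : W) : Prop :=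
  DifferentiableAt ℝ (α.inChart x) (extChartAt I x x)

theorem OneForm.inChart_apply (α : OneForm I W) (x : W) (y : E) (v : Fin 1 → E) :
    α.inChart x y v = α ((extChartAt I x).symm y)
      (mfderivWithin 𝓘(ℝ, E) I (extChartAt I x).symm (Set.range I) y (v 0)) :=
  rfl

theorem OneForm.inChart_add (α β : OneForm I W) (x : W) :
    OneForm.inChart (fun z => α z + β z) x = α.inChart x + β.inChart x :=
  rfl

theorem OneForm.inChart_smul (c : ℝ) (α : OneForm I W) (x : W) :
    OneForm.inChart (fun z => c • α z) x = c • α.inChart x :=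
  rfl

theorem OneForm.IsRegularAt.add {α β : OneForm I W} {x : W} (hα : α.IsRegularAt x)
    (hβ : β.IsRegularAt x) : OneForm.IsRegularAt (fun z => α z + β z) x := by
  unfold OneForm.IsRegularAt
  rw [OneForm.inChart_add]
  exact DifferentiableAt.add hα hβ

theorem OneForm.d_smul [I.Boundaryless] (c : ℝ) (α : OneForm I W) (x : W)
    (u v : TangentSpace I x) :
    OneForm.d (fun z => c • α z) x u v = c * α.d x u v := by
  unfold OneForm.d
  rw [OneForm.inChart_smul, I.range_eq_univ, extDerivWithin_univ, extDerivWithin_univ, extDeriv_smul]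
  rfl

theorem OneForm.d_self (α : OneForm I W) (x : W) (u : TangentSpace I x) : α.d x u u = 0 :=
  (extDerivWithin (α.inChart x) (Set.range I) (extChartAt I x x)).map_eq_zero_of_eq _
    (i := 0) (j := 1) rfl (by decide)

theorem OneForm.pullback_comp {f : W → W'} {g : W' → W''} (hf : MDifferentiable I I' f)
    (hg : MDifferentiable I' I'' g) (α : OneForm I'' W'') :
    OneForm.pullback I (g ∘ f) α = OneForm.pullback I f (OneForm.pullback I' g α) := by
  funext x
  simp only [OneForm.pullback]
  rw [mfderiv_comp x (hg _) (hf x)]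
  rfl

/-- In charts, the pullback of a `1`-form is the pullback by the local expression of the map. -/
theorem OneForm.inChart_pullback [I.Boundaryless] [I'.Boundaryless] [IsManifold I ∞ W]
    [IsManifold I' ∞ W'] {f : W → W'} {x : W} (hf : ContMDiffAt I I' ∞ f x) (α : OneForm I' W') :
    (OneForm.pullback I f α).inChart x =ᶠ[𝓝 (extChartAt I x x)] fun y =>
      (α.inChart (f x) (writtenInExtChartAt I I' x f y)).compContinuousLinearMap
        (fderiv ℝ (writtenInExtChartAt I I' x f) y) := by
  have : IsManifold I 1 W := .of_le (n := ∞) (by simp)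
  have : IsManifold I' 1 W' := .of_le (n := ∞) (by simp)
  have hf1 : ∀ᶠ p in 𝓝 x, ContMDiffAt I I' 1 f p :=
    (contMDiffAt_iff_contMDiffAt_nhds (by simp)).1 (hf.of_le (by simp))
  have hsrc : ∀ᶠ p in 𝓝 x, f p ∈ (extChartAt I' (f x)).source :=
    hf.continuousAt.eventually (extChartAt_source_mem_nhds (f x))
  have hsymm : Filter.Tendsto (extChartAt I x).symm (𝓝 (extChartAt I x x)) (𝓝 x) := by
    have := continuousAt_extChartAt_symm (I := I) x
    rwa [ContinuousAt, extChartAt_to_inv] at this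
  filter_upwards [hsymm.eventually hf1, (hsymm.eventually hsrc).eventually_nhds,
    (extChartAt_target_mem_nhds (I := I) x)] with y hy1 hy2 hy3
  set p := (extChartAt I x).symm y with hp
  have hF : writtenInExtChartAt I I' x f y = extChartAt I' (f x) (f p) := rfl
  have hq : (extChartAt I' (f x)).symm (extChartAt I' (f x) (f p)) = f p :=
    (extChartAt I' (f x)).left_inv hy2.self_of_nhds
  have hdS : MDifferentiableAt 𝓘(ℝ, E) I (extChartAt I x).symm y := by
    have := mdifferentiableWithinAt_extChartAt_symm (I := I) hy3
    rwa [I.range_eq_univ, mdifferentiableWithinAt_univ] at this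
  have hdf : MDifferentiableAt I I' f p := hy1.mdifferentiableAt (by simp)
  have hdE : MDifferentiableAt I' 𝓘(ℝ, E') (extChartAt I' (f x)) (f p) :=
    mdifferentiableAt_extChartAt (by rw [← extChartAt_source I']; exact hy2.self_of_nhds)
  have hdS' : MDifferentiableAt 𝓘(ℝ, E') I' (extChartAt I' (f x)).symm
      (extChartAt I' (f x) (f p)) := by
    have := mdifferentiableWithinAt_extChartAt_symm (I := I')
      ((extChartAt I' (f x)).map_source hy2.self_of_nhds)
    rwa [I'.range_eq_univ, mdifferentiableWithinAt_univ] at this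
  have hdF : MDifferentiableAt 𝓘(ℝ, E) 𝓘(ℝ, E') (writtenInExtChartAt I I' x f) y :=
    hdE.comp y (hdf.comp y hdS)
  -- near `y`, the chart inverse composed with the local expression is `f` after the chart inverse
  have hev : (extChartAt I' (f x)).symm ∘ writtenInExtChartAt I I' x f =ᶠ[𝓝 y]
      f ∘ (extChartAt I x).symm := by
    filter_upwards [hy2] with z hz
    exact (extChartAt I' (f x)).left_inv hz
  have key := hev.mfderiv_eq (I := 𝓘(ℝ, E)) (I' := I')
  rw [mfderiv_comp y hdf hdS, mfderiv_comp y hdS' hdF, mfderiv_eq_fderiv] at key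
  ext v
  rw [ContinuousAlternatingMap.compContinuousLinearMap_apply, OneForm.inChart_apply,
    OneForm.inChart_apply, I.range_eq_univ, I'.range_eq_univ, mfderivWithin_univ,
    mfderivWithin_univ, hF]
  have h1 : ∀ q : W', q = f p → ∀ w : E', α q w = α (f p) w := by rintro q rfl w; rfl
  refine Eq.trans ?_ (h1 _ hq _).symm
  exact congrArg (α (f p)) (congrArg (fun T : E →L[ℝ] E' => T (v 0)) key).symm

theorem contDiffAt_writtenInExtChartAt [I.Boundaryless] [IsManifold I ∞ W]
    [IsManifold I' ∞ W'] {f : W → W'} {x : W} (hf : ContMDiffAt I I' ∞ f x) :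
    ContDiffAt ℝ ∞ (writtenInExtChartAt I I' x f) (extChartAt I x x) := by
  have := (contMDiffAt_iff.1 hf).2
  rwa [I.range_eq_univ, contDiffWithinAt_univ] at this

theorem writtenInExtChartAt_self (f : W → W') (x : W) :
    writtenInExtChartAt I I' x f (extChartAt I x x) = extChartAt I' (f x) (f x) := by
  simp [writtenInExtChartAt]

theorem OneForm.IsRegularAt.pullback [I.Boundaryless] [I'.Boundaryless] [IsManifold I ∞ W]
    [IsManifold I' ∞ W'] {f : W → W'} {x : W} (hf : ContMDiffAt I I' ∞ f x) {α : OneForm I' W'}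
    (hα : α.IsRegularAt (f x)) : (OneForm.pullback I f α).IsRegularAt x := by
  refine DifferentiableAt.congr_of_eventuallyEq ?_ (OneForm.inChart_pullback hf α)
  have hF := contDiffAt_writtenInExtChartAt hf
  have hα' : DifferentiableAt ℝ (α.inChart (f x))
      (writtenInExtChartAt I I' x f (extChartAt I x x)) := by
    rw [writtenInExtChartAt_self]; exact hα
  exact DifferentiableAt.continuousAlternatingMapCompContinuousLinearMap
    (DifferentiableAt.comp (g := α.inChart (f x)) _ hα' (hF.differentiableAt (by simp)))
    ((hF.fderiv_right (m := 1) (by norm_cast)).differentiableAt (by simp))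

/-- The exterior derivative commutes with pullback. -/
theorem OneForm.d_pullback [I.Boundaryless] [I'.Boundaryless] [IsManifold I ∞ W]
    [IsManifold I' ∞ W'] {f : W → W'} {x : W} (hf : ContMDiffAt I I' ∞ f x) {α : OneForm I' W'}
    (hα : α.IsRegularAt (f x)) (u v : TangentSpace I x) :
    (OneForm.pullback I f α).d x u v = α.d (f x) (mfderiv I I' f x u) (mfderiv I I' f x v) := by
  have : IsManifold I 1 W := .of_le (n := ∞) (by simp)
  have : IsManifold I' 1 W' := .of_le (n := ∞) (by simp)
  have hα' : DifferentiableAt ℝ (α.inChart (f x))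
      (writtenInExtChartAt I I' x f (extChartAt I x x)) := by
    rw [writtenInExtChartAt_self]; exact hα
  have hmf : mfderiv I I' f x = fderiv ℝ (writtenInExtChartAt I I' x f) (extChartAt I x x) := by
    rw [(hf.mdifferentiableAt (by simp)).mfderiv, I.range_eq_univ, fderivWithin_univ]
  unfold OneForm.d
  rw [I.range_eq_univ, I'.range_eq_univ, extDerivWithin_univ, extDerivWithin_univ,
    (OneForm.inChart_pullback hf α).extDeriv_eq,
    extDeriv_pullback hα' (contDiffAt_writtenInExtChartAt hf)
      (by simpa using WithTop.coe_le_coe.2 (le_top : (2 : ℕ∞) ≤ ⊤)),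
    writtenInExtChartAt_self, mfderiv_extChartAt_self, mfderiv_extChartAt_self, hmf,
    ContinuousAlternatingMap.compContinuousLinearMap_apply]
  congr 1
  ext i
  fin_cases i <;> rfl

/-- A smooth `1`-form is regular at every point. -/
theorem OneForm.IsSmooth.isRegularAt [I.Boundaryless] [IsManifold I ∞ W] {α : OneForm I W}
    (hα : α.IsSmooth) (x : W) : α.IsRegularAt x := by
  have : IsManifold I 1 W := .of_le (n := ∞) (by simp)
  have h := ((contMDiffAt_hom_bundle _).1 (hα x)).2
  have hsymm : ContMDiffAt 𝓘(ℝ, E) I ∞ (extChartAt I x).symm (extChartAt I x x) :=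
    (contMDiffOn_extChartAt_symm x).contMDiffAt (extChartAt_target_mem_nhds x)
  have h2 := (ContMDiffAt.comp_of_eq h hsymm (extChartAt_to_inv x)).contDiffAt.differentiableAt
    (by simp)
  have h3 := (ContinuousAlternatingMap.ofSubsingletonLIE (𝕜 := ℝ) (E := E) (F := ℝ)
    (0 : Fin 1)).toContinuousLinearEquiv.differentiableAt.comp _ h2
  refine h3.congr_of_eventuallyEq ?_
  filter_upwards [extChartAt_target_mem_nhds (I := I) x] with y hy
  have hs : (extChartAt I x).symm y ∈ (chartAt H x).source := by
    simpa using (extChartAt I x).map_target hy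
  ext v
  have hS := TangentBundle.symmL_trivializationAt (𝕜 := ℝ) (I := I) hs
  rw [(extChartAt I x).right_inv hy] at hS
  rw [OneForm.inChart_apply, ← hS]
  simp [ContinuousLinearMap.inCoordinates]
  rfl

end Forms

/-! ### The Liouville flow -/

section Liouville

variable {E : Type*} [NormedAddCommGroup E] [NormedSpace ℝ E]
  {H : Type*} [TopologicalSpace H] {I : ModelWithCorners ℝ E H}
  {W : Type*} [TopologicalSpace W] [ChartedSpace H W]

/-- If `β(∂ₜ)` vanishes near `(t, y)`, then the term `v(β(∂ₜ))` of `dβ(∂ₜ, v)` vanishes, so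
`dβ(∂ₜ, v)` is the time derivative of `β(v)` for a constant vector field `v`. -/
theorem OneForm.hasDerivAt_of_eventually_eq_zero {β : OneForm 𝓘(ℝ, ℝ × E) (ℝ × E)} {t : ℝ} {y : E}
    (hβ : β.IsRegularAt (t, y)) (hu : ∀ᶠ z in 𝓝 (t, y), β z ((1, 0) : ℝ × E) = 0) (v : ℝ × E) :
    HasDerivAt (fun s : ℝ => β (s, y) v) (β.d (t, y) ((1, 0) : ℝ × E) v) t := by
  have hval : ∀ z w : ℝ × E, β.inChart (t, y) z ![w] = β z w := by
    intro y w
    rw [OneForm.inChart_apply, modelWithCornersSelf_coe, Set.range_id, mfderivWithin_univ,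
      extChartAt_model_space_eq_id]
    exact congrArg (β y) (congrArg (fun T : ℝ × E →L[ℝ] ℝ × E => T w) mfderiv_id)
  have hd : DifferentiableAt ℝ (β.inChart (t, y)) (t, y) := by
    have e : extChartAt 𝓘(ℝ, ℝ × E) (t, y) (t, y) = (t, y) := by
      rw [extChartAt_model_space_eq_id]; rfl
    unfold OneForm.IsRegularAt at hβ
    rwa [e] at hβ
  have hd' : DifferentiableAt ℝ (fun z => β z v) (t, y) := by
    have := hd.continuousAlternatingMap_apply (g := fun i _ => ![v] i) (by simp)
    exact this.congr_of_eventuallyEq (.of_forall fun z => (hval z v).symm)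
  have hform : β.d (t, y) ((1, 0) : ℝ × E) v = fderiv ℝ (fun z => β z v) (t, y) (1, 0) := by
    have h0 : fderiv ℝ (fun z => β z ((1, 0) : ℝ × E)) (t, y) = 0 := by
      have : (fun z => β z ((1, 0) : ℝ × E)) =ᶠ[𝓝 (t, y)] fun _ => (0 : ℝ) := hu
      rw [this.fderiv_eq]
      exact fderiv_const_apply _
    unfold OneForm.d
    rw [modelWithCornersSelf_coe, Set.range_id, extDerivWithin_univ]
    rw [mfderiv_extChartAt_self, extChartAt_model_space_eq_id]
    refine (extDeriv_apply hd _).trans ?_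
    have e0 : (0 : Fin 2).removeNth ![((1, 0) : ℝ × E), v] = ![v] := by
      ext i <;> fin_cases i <;> rfl
    have e1 : (1 : Fin 2).removeNth ![((1, 0) : ℝ × E), v] = ![((1, 0) : ℝ × E)] := by
      ext i <;> fin_cases i <;> rfl
    have c1 : fderiv ℝ (fun z => β.inChart (t, y) z ![((1, 0) : ℝ × E)]) (t, y) = 0 := by
      rw [← h0]; congr 1; ext z; exact hval z _
    have c0 : fderiv ℝ (fun z => β.inChart (t, y) z ![v]) (t, y) =
        fderiv ℝ (fun z => β z v) (t, y) := by
      congr 1; ext z; exact hval z _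
    rw [Fin.sum_univ_two]
    -- the vectors here carry tangent space types, which agree with `ℝ × E` only definitionally
    erw [e0, e1]
    rw [c0, c1]
    change (-1 : ℤ) ^ 0 • fderiv ℝ (fun z => β z v) (t, y) (1, 0) + (-1 : ℤ) ^ 1 • (0 : ℝ) = _
    simp
  rw [hform]
  have hline : HasDerivAt (fun s : ℝ => (s, y)) ((1, 0) : ℝ × E) t :=
    (hasDerivAt_id t).prodMk (hasDerivAt_const t y)
  exact hd'.hasFDerivAt.comp_hasDerivAt t hline

/-- The Liouville form vanishes on the Liouville field: `α(X) = dα(X, X) = 0`. -/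
theorem IsLiouvilleField.apply_self {α : OneForm I W} {X : (x : W) → TangentSpace I x}
    (hX : IsLiouvilleField α X) (x : W) : α x (X x) = 0 := by
  rw [← hX x (X x), OneForm.d_self]

/-- The Liouville flow rescales the Liouville form: `ψₜ^* α = e^t α`. For a tangent vector `v` at
`x`, extended to a constant vector field in a chart at `x`, and `β = Ψ^* α` for the map
`Ψ : (t, y) ↦ ψₜ(y)`, one has `β(∂ₜ) = α(X) = 0`, so that
`∂ₜ (β(v)) = dβ(∂ₜ, v) = dα(X, dψₜ v) = α(dψₜ v) = β(v)`. -/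
theorem IsLiouvilleFlow.pullback_eq [I.Boundaryless] [IsManifold I ∞ W] {α : OneForm I W}
    (hα : ∀ x, α.IsRegularAt x) {ψ : ℝ → W → W} (hψ : IsLiouvilleFlow α ψ) (t : ℝ) :
    OneForm.pullback I (ψ t) α = fun x => Real.exp t • α x := by
  have : IsManifold I 1 W := .of_le (n := ∞) (by simp)
  obtain ⟨X, hX, hXψ⟩ := hψ.integralCurve
  funext x
  ext v
  set y₀ := extChartAt I x x with hy₀
  set h : ℝ × E → W := fun p => ψ p.1 ((extChartAt I x).symm p.2) with hh
  have hsymm : ∀ y ∈ (extChartAt I x).target,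
      ContMDiffAt 𝓘(ℝ, E) I ∞ (extChartAt I x).symm y := fun y hy =>
    (contMDiffOn_extChartAt_symm x).contMDiffAt
      ((isOpen_extChartAt_target (I := I) x).mem_nhds hy)
  have hmem : y₀ ∈ (extChartAt I x).target := mem_extChartAt_target x
  have hsm : ∀ s : ℝ, ∀ y ∈ (extChartAt I x).target,
      ContMDiffAt 𝓘(ℝ, ℝ × E) I ∞ h (s, y) := by
    intro s y hy
    have h1 : ContMDiffAt 𝓘(ℝ, ℝ × E) 𝓘(ℝ, ℝ) ∞ (Prod.fst : ℝ × E → ℝ) (s, y) :=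
      contDiff_fst.contMDiff.contMDiffAt
    have h2 : ContMDiffAt 𝓘(ℝ, ℝ × E) 𝓘(ℝ, E) ∞ (Prod.snd : ℝ × E → E) (s, y) :=
      contDiff_snd.contMDiff.contMDiffAt
    exact hψ.smooth.contMDiffAt.comp (s, y) (h1.prodMk ((hsymm y hy).comp (s, y) h2))
  have hdt : ∀ s : ℝ, ∀ y ∈ (extChartAt I x).target,
      mfderiv 𝓘(ℝ, ℝ × E) I h (s, y) ((1, 0) : ℝ × E) = X (h (s, y)) := by
    intro s y hy
    have h1 : HasMFDerivAt 𝓘(ℝ, ℝ) 𝓘(ℝ, ℝ × E) (fun r : ℝ => (r, y)) s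
        (ContinuousLinearMap.inl ℝ ℝ E) :=
      (hasFDerivAt_prodMk_left s y).hasMFDerivAt
    have h2 := ((hsm s y hy).mdifferentiableAt (by simp)).hasMFDerivAt.comp s h1
    have h3 := hasMFDerivAt_unique h2 (hXψ ((extChartAt I x).symm y) s)
    have h4 := congrArg (fun T : ℝ →L[ℝ] E => T 1) h3
    refine Eq.trans ?_ (h4.trans ?_)
    · rfl
    · exact one_smul ℝ (X (h (s, y)) : E)
  have hdv : ∀ s : ℝ, mfderiv 𝓘(ℝ, ℝ × E) I h (s, y₀) ((0, v) : ℝ × E) =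
      mfderiv I I (ψ s) x v := by
    intro s
    have h1 : HasMFDerivAt 𝓘(ℝ, E) 𝓘(ℝ, ℝ × E) (fun y : E => (s, y)) y₀
        (ContinuousLinearMap.inr ℝ ℝ E) :=
      (hasFDerivAt_prodMk_right s y₀).hasMFDerivAt
    have h2 := ((hsm s y₀ hmem).mdifferentiableAt (by simp)).hasMFDerivAt.comp y₀ h1
    have h3 : HasMFDerivAt 𝓘(ℝ, E) I (extChartAt I x).symm y₀ (ContinuousLinearMap.id ℝ E) := by
      have := ((hsymm y₀ hmem).mdifferentiableAt (by simp)).hasMFDerivAt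
      have e := mfderivWithin_range_extChartAt_symm (I := I) (x := x)
      rw [I.range_eq_univ, mfderivWithin_univ] at e
      rw [e] at this
      exact this
    have h4 : MDifferentiableAt I I (ψ s) ((extChartAt I x).symm y₀) :=
      ((hψ.smooth.comp (contMDiff_const.prodMk contMDiff_id) :
        ContMDiff I I ∞ (ψ s)).contMDiffAt).mdifferentiableAt (by simp)
    have h5 := hasMFDerivAt_unique h2 (h4.hasMFDerivAt.comp y₀ h3)
    have h6 := congrArg (fun T : E →L[ℝ] E => T v) h5
    have h7 : (extChartAt I x).symm y₀ = x := extChartAt_to_inv x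
    refine Eq.trans ?_ (h6.trans ?_)
    · rfl
    · rw [h7]; rfl
  set β : OneForm 𝓘(ℝ, ℝ × E) (ℝ × E) := OneForm.pullback 𝓘(ℝ, ℝ × E) h α with hβ
  have hval : ∀ s : ℝ, β (s, y₀) ((0, v) : ℝ × E) = OneForm.pullback I (ψ s) α x v := by
    intro s
    have h7 : (extChartAt I x).symm y₀ = x := extChartAt_to_inv x
    have h8 : h (s, y₀) = ψ s x := by simp only [hh, h7]
    have h9 : ∀ q, q = ψ s x → ∀ w : E, α q w = α (ψ s x) w := by rintro _ rfl w; rfl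
    exact (h9 _ h8 _).trans (congrArg (α (ψ s x)) (hdv s))
  have hode : ∀ s : ℝ, HasDerivAt (fun s => OneForm.pullback I (ψ s) α x v)
      (OneForm.pullback I (ψ s) α x v) s := by
    intro s
    have hreg : β.IsRegularAt (s, y₀) := (hα _).pullback (hsm s y₀ hmem)
    have hz : ∀ᶠ z in 𝓝 (s, y₀), β z ((1, 0) : ℝ × E) = 0 := by
      have : ∀ᶠ z : ℝ × E in 𝓝 (s, y₀), z.2 ∈ (extChartAt I x).target :=
        continuousAt_snd.eventually (extChartAt_target_mem_nhds (I := I) x)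
      filter_upwards [this] with z hz
      exact (congrArg (α (h z)) (hdt z.1 z.2 hz)).trans (hX.apply_self _)
    have hd := OneForm.hasDerivAt_of_eventually_eq_zero hreg hz ((0, v) : ℝ × E)
    have hdβ : β.d (s, y₀) ((1, 0) : ℝ × E) ((0, v) : ℝ × E) = β (s, y₀) ((0, v) : ℝ × E) := by
      refine (OneForm.d_pullback (hsm s y₀ hmem) (hα _) _ _).trans ?_
      exact (congrArg (fun w => α.d (h (s, y₀)) w _) (hdt s y₀ hmem)).trans (hX _ _)
    rw [hdβ] at hd
    simpa only [hval] using hd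
  -- the solution of the differential equation is determined by its initial value
  have hconst : ∀ s : ℝ, HasDerivAt
      (fun s => Real.exp (-s) * OneForm.pullback I (ψ s) α x v) 0 s := by
    intro s
    refine (((hasDerivAt_neg s).exp).mul (hode s)).congr_deriv ?_
    ring
  have h0 := is_const_of_deriv_eq_zero (fun s => (hconst s).differentiableAt)
    (fun s => (hconst s).deriv) t 0
  have hψ0 : OneForm.pullback I (ψ 0) α x v = α x v := by
    have : ψ 0 = id := funext hψ.zero
    rw [this]
    simp only [OneForm.pullback]
    rw [mfderiv_id]
    rfl
  simp only [neg_zero, Real.exp_zero, one_mul, hψ0, Real.exp_neg] at h0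
  have hpos := Real.exp_pos t
  rw [inv_mul_eq_iff_eq_mul₀ hpos.ne'] at h0
  simpa using h0

theorem IsLiouvilleFlow.contMDiff {α : OneForm I W} {ψ : ℝ → W → W} (hψ : IsLiouvilleFlow α ψ)
    (t : ℝ) : ContMDiff I I ∞ (ψ t) :=
  hψ.smooth.comp (contMDiff_const.prodMk contMDiff_id)

/-- The flow is a one-parameter group, by uniqueness of integral curves: its velocity field is
smooth because the flow is. -/
theorem IsLiouvilleFlow.add [T2Space W] [CompleteSpace E] [I.Boundaryless] [IsManifold I ∞ W]
    {α : OneForm I W} {ψ : ℝ → W → W} (hψ : IsLiouvilleFlow α ψ) (s t : ℝ) (x : W) :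
    ψ (s + t) x = ψ s (ψ t x) := by
  have : IsManifold I 1 W := .of_le (n := ∞) (by simp)
  obtain ⟨X, hX, hXψ⟩ := hψ.integralCurve
  have hXs : ContMDiff I I.tangent 1 (fun x => (⟨x, X x⟩ : TangentBundle I W)) := by
    have h1 := hψ.smooth.contMDiff_tangentMap (m := 1) (by norm_cast)
    have h2 : ContMDiff I (𝓘(ℝ, ℝ).tangent.prod I.tangent) 1
        (fun x : W => ((⟨0, 1⟩ : TangentBundle 𝓘(ℝ, ℝ) ℝ), (⟨x, 0⟩ : TangentBundle I W))) :=
      contMDiff_const.prodMk (Bundle.contMDiff_zeroSection ℝ (TangentSpace I : W → Type _))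
    have h3 := h1.comp ((contMDiff_equivTangentBundleProd_symm (I := 𝓘(ℝ, ℝ)) (M := ℝ)
      (I' := I) (M' := W) (n := 1)).comp h2)
    refine h3.congr fun x => ?_
    have h4 : HasMFDerivAt 𝓘(ℝ, ℝ) (𝓘(ℝ, ℝ).prod I) (fun r : ℝ => (r, x)) 0
        (ContinuousLinearMap.inl ℝ ℝ E) := by
      have := (hasMFDerivAt_id (I := 𝓘(ℝ, ℝ)) (0 : ℝ)).prodMk
        (hasMFDerivAt_const (I := 𝓘(ℝ, ℝ)) (I' := I) x (0 : ℝ))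
      exact this
    have h5 := ((hψ.smooth.contMDiffAt (x := ((0 : ℝ), x))).mdifferentiableAt
      (by simp)).hasMFDerivAt.comp (0 : ℝ) h4
    have h6 := hasMFDerivAt_unique h5 (hXψ x 0)
    have h7 := congrArg (fun T : ℝ →L[ℝ] E => T 1) h6
    have h8 : ∀ (q : W) (w : E), q = x → w = X q →
        (⟨x, X x⟩ : TangentBundle I W) = ⟨q, w⟩ := by
      rintro _ _ rfl rfl; rfl
    exact h8 _ _ (hψ.zero x) (h7.trans (one_smul ℝ (X (ψ 0 x) : E)))
  have := isMIntegralCurve_Ioo_eq_of_contMDiff_boundaryless (t₀ := 0) hXs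
    ((hXψ x).comp_add t) (hXψ (ψ t x)) (by simp [hψ.zero])
  exact congrFun this s

/-- The Liouville flow at a fixed time, as a diffeomorphism. -/
def IsLiouvilleFlow.diffeomorph [T2Space W] [CompleteSpace E] [I.Boundaryless] [IsManifold I ∞ W]
    {α : OneForm I W} {ψ : ℝ → W → W} (hψ : IsLiouvilleFlow α ψ) (t : ℝ) : W ≃ₘ⟮I, I⟯ W where
  toFun := ψ t
  invFun := ψ (-t)
  left_inv x := by rw [← hψ.add, neg_add_cancel, hψ.zero]
  right_inv x := by rw [← hψ.add, add_neg_cancel, hψ.zero]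
  contMDiff_toFun := hψ.contMDiff t
  contMDiff_invFun := hψ.contMDiff (-t)

end Liouville

/-! ### Images of exact Lagrangian submanifolds under diffeomorphisms -/

section Transport

variable {E : Type*} [NormedAddCommGroup E] [NormedSpace ℝ E]
  {H : Type*} [TopologicalSpace H] {I : ModelWithCorners ℝ E H}
  {E' : Type*} [NormedAddCommGroup E'] [NormedSpace ℝ E']
  {H' : Type*} [TopologicalSpace H'] {I' : ModelWithCorners ℝ E' H'}

/-- The charted space structure transported along a homeomorphism `h`. Its charts are the
`e ∘ h⁻¹`, with the full domain `h(dom e)`. -/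
abbrev transportChartedSpace {X Y : Type*} [TopologicalSpace X] [TopologicalSpace Y]
    [ChartedSpace H X] (h : X ≃ₜ Y) : ChartedSpace H Y where
  atlas := (fun e => h.symm.transOpenPartialHomeomorph e) '' atlas H X
  chartAt y := h.symm.transOpenPartialHomeomorph (chartAt H (h.symm y))
  mem_chart_source y := by simp
  chart_mem_atlas y := ⟨_, chart_mem_atlas H _, rfl⟩

theorem isManifold_transport {X Y : Type*} [TopologicalSpace X] [TopologicalSpace Y]
    [ChartedSpace H X] [IsManifold I ∞ X] (h : X ≃ₜ Y) :
    @IsManifold ℝ _ E _ _ H _ I ∞ Y _ (transportChartedSpace h) := by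
  let := transportChartedSpace (H := H) h
  have : HasGroupoid Y (contDiffGroupoid ∞ I) := by
    refine ⟨?_⟩
    rintro _ _ ⟨e, he, rfl⟩ ⟨e', he', rfl⟩
    have h1 : (h.symm.transOpenPartialHomeomorph e).symm ≫ₕ h.symm.transOpenPartialHomeomorph e' =
        e.symm ≫ₕ e' := by
      refine OpenPartialHomeomorph.ext _ _ (fun x => ?_) (fun x => ?_) ?_
      · simp
      · simp
      · ext x
        simp
    change (h.symm.transOpenPartialHomeomorph e).symm ≫ₕ h.symm.transOpenPartialHomeomorph e' ∈ _
    rw [h1]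
    exact HasGroupoid.compatible he he'
  exact IsManifold.mk' I ∞ Y

/-- The homeomorphism along which a charted space structure is transported becomes a
diffeomorphism. -/
def transportDiffeomorph {X Y : Type*} [TopologicalSpace X] [TopologicalSpace Y]
    [ChartedSpace H X] [IsManifold I ∞ X] (h : X ≃ₜ Y) :
    letI := transportChartedSpace (H := H) h
    X ≃ₘ⟮I, I⟯ Y :=
  letI := transportChartedSpace (H := H) h
  { toEquiv := h.toEquiv
    contMDiff_toFun := by
      have := isManifold_transport (I := I) h
      intro x
      -- near `x`, the map `h` is a chart of `X` followed by the inverse of its transport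
      have he := IsManifold.chart_mem_maximalAtlas (I := I) (n := ∞) x
      have he' : h.symm.transOpenPartialHomeomorph (chartAt H x) ∈
          IsManifold.maximalAtlas I ∞ Y :=
        IsManifold.subset_maximalAtlas ⟨_, chart_mem_atlas H x, rfl⟩
      have hc := (contMDiffAt_symm_of_mem_maximalAtlas he' (x := chartAt H x x) (by simp)).comp x
        (contMDiffAt_of_mem_maximalAtlas he (mem_chart_source H x))
      refine hc.congr_of_eventuallyEq ?_
      filter_upwards [(chartAt H x).open_source.mem_nhds (mem_chart_source H x)] with z hz
      simp [hz]
    contMDiff_invFun := by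
      have := isManifold_transport (I := I) h
      intro y
      have he := IsManifold.chart_mem_maximalAtlas (I := I) (n := ∞) (h.symm y)
      have he' : h.symm.transOpenPartialHomeomorph (chartAt H (h.symm y)) ∈
          IsManifold.maximalAtlas I ∞ Y :=
        IsManifold.subset_maximalAtlas ⟨_, chart_mem_atlas H _, rfl⟩
      have hc := (contMDiffAt_symm_of_mem_maximalAtlas he
        (x := chartAt H (h.symm y) (h.symm y)) (by simp)).comp y
        (contMDiffAt_of_mem_maximalAtlas he' (x := y) (by simp))
      refine hc.congr_of_eventuallyEq ?_
      filter_upwards [(h.symm.transOpenPartialHomeomorph (chartAt H (h.symm y))).open_source.mem_nhds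
        (x := y) (by simp)] with z hz
      have hz' : h.symm z ∈ (chartAt H (h.symm y)).source := by simpa using hz
      simp [hz'] }

/-- Composing a chart of the maximal atlas with the inverse of a diffeomorphism gives a chart of the
maximal atlas of the target. -/
theorem mem_maximalAtlas_transOpenPartialHomeomorph {X Y : Type*} [TopologicalSpace X]
    [TopologicalSpace Y] [ChartedSpace H X] [ChartedSpace H Y] [IsManifold I ∞ X]
    [IsManifold I ∞ Y] (Φ : X ≃ₘ⟮I, I⟯ Y) {e : OpenPartialHomeomorph X H}
    (he : e ∈ IsManifold.maximalAtlas I ∞ X) :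
    Φ.toHomeomorph.symm.transOpenPartialHomeomorph e ∈ IsManifold.maximalAtlas I ∞ Y := by
  rw [IsManifold.mem_maximalAtlas_iff_contMDiffOn] at he ⊢
  exact ⟨he.1.comp Φ.symm.contMDiff.contMDiffOn fun y hy => hy,
    Φ.contMDiff.comp_contMDiffOn he.2⟩

/-- Conjugating a smooth embedding by diffeomorphisms of its source and its target gives a smooth
embedding. -/
theorem isSmoothEmbedding_conj {X Y Z W : Type*} [TopologicalSpace X] [TopologicalSpace Y]
    [TopologicalSpace Z] [TopologicalSpace W]
    [ChartedSpace H X] [ChartedSpace H Y] [IsManifold I ∞ X] [IsManifold I ∞ Y]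
    [ChartedSpace H' Z] [ChartedSpace H' W] [IsManifold I' ∞ Z] [IsManifold I' ∞ W]
    (h : X ≃ₘ⟮I, I⟯ Y) (Φ : Z ≃ₘ⟮I', I'⟯ W) {f : X → Z} {g : Y → W}
    (hg : g ∘ h = Φ ∘ f) (hf : Manifold.IsSmoothEmbedding I I' ∞ f) :
    Manifold.IsSmoothEmbedding I I' ∞ g := by
  have hg' : g = Φ ∘ f ∘ h.symm := by
    rw [← Function.comp_assoc, ← hg]
    funext y
    simp
  refine ⟨?_, ?_⟩
  · obtain ⟨F, _, _, hF⟩ := hf.isImmersion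
    refine ⟨F, inferInstance, inferInstance, fun y => ?_⟩
    have k := hF (h.symm y)
    -- in the transported charts `g` has the same local expression as `f`
    refine Manifold.IsImmersionAtOfComplement.mk_of_charts k.equiv
      (h.toHomeomorph.symm.transOpenPartialHomeomorph k.domChart)
      (Φ.toHomeomorph.symm.transOpenPartialHomeomorph k.codChart) k.mem_domChart_source ?_
      (mem_maximalAtlas_transOpenPartialHomeomorph h k.domChart_mem_maximalAtlas)
      (mem_maximalAtlas_transOpenPartialHomeomorph Φ k.codChart_mem_maximalAtlas) ?_ ?_
    · have := k.mem_codChart_source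
      rw [hg']
      simpa using this
    · intro z hz
      have := k.source_subset_preimage_source hz
      rw [hg']
      simpa using this
    · intro z hz
      refine Eq.trans ?_ (k.writtenInCharts hz)
      rw [hg']
      simp
  · rw [hg']
    exact Φ.toHomeomorph.isEmbedding.comp (hf.isEmbedding.comp h.symm.toHomeomorph.isEmbedding)

variable {W : Type*} [TopologicalSpace W] [ChartedSpace H W]

/-- A diffeomorphism `Φ` with `Φ^* α = c α` maps exact Lagrangian submanifolds to exact Lagrangian
submanifolds: if `f` is a primitive of `α` on `V`, then `c (f ∘ Φ⁻¹)` is one on `Φ(V)`. -/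
theorem IsExactLagrangian.image [I.Boundaryless] [IsManifold I ∞ W] {α : OneForm I W}
    (hα : ∀ x, α.IsRegularAt x) {k : ℕ} {V : Set W} (hV : IsExactLagrangian α k V)
    (Φ : W ≃ₘ⟮I, I⟯ W) {c : ℝ} (hΦ : OneForm.pullback I Φ α = fun x => c • α x) :
    IsExactLagrangian α k (Φ '' V) := by
  obtain ⟨cs, hdim, hman, hemb, hiso, f, hf, hex⟩ := hV
  let h₀ : V ≃ₜ (Φ '' V) := Φ.toHomeomorph.image V
  let := transportChartedSpace (H := EuclideanSpace ℝ (Fin k)) h₀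
  have : IsManifold (𝓡 k) ∞ (Φ '' V) := isManifold_transport h₀
  let h : V ≃ₘ⟮𝓡 k, 𝓡 k⟯ (Φ '' V) := transportDiffeomorph h₀
  have hcomm : (Subtype.val : Φ '' V → W) ∘ h = Φ ∘ (Subtype.val : V → W) := rfl
  have hval : (Subtype.val : Φ '' V → W) = Φ ∘ (Subtype.val : V → W) ∘ h.symm := by
    rw [← Function.comp_assoc, ← hcomm]
    funext y
    simp
  have hdV : MDifferentiable (𝓡 k) I (Subtype.val : V → W) :=
    hemb.contMDiff.mdifferentiable (by simp)
  have hdΦ : MDifferentiable I I Φ := Φ.mdifferentiable (by simp)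
  have hdh : MDifferentiable (𝓡 k) (𝓡 k) h.symm := h.symm.mdifferentiable (by simp)
  refine ⟨inferInstance, hdim, inferInstance, isSmoothEmbedding_conj h Φ hcomm hemb, ?_,
    fun y => c * f (h.symm y), contMDiff_const.mul (hf.comp h.symm.contMDiff), ?_⟩
  · intro p u v
    have hder : ∀ w : EuclideanSpace ℝ (Fin k),
        mfderiv (𝓡 k) I (Subtype.val : Φ '' V → W) p w =
        mfderiv I I Φ (h.symm p : W) (mfderiv (𝓡 k) I (Subtype.val : V → W) (h.symm p)
          (mfderiv (𝓡 k) (𝓡 k) h.symm p w)) := by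
      intro w
      rw [hval, mfderiv_comp p (hdΦ _) ((hdV _).comp p (hdh _)), mfderiv_comp p (hdV _) (hdh _)]
      rfl
    have hp : (p : W) = Φ (h.symm p : W) := congrFun hval p
    have key := OneForm.d_pullback (Φ.contMDiff.contMDiffAt (x := (h.symm p : W)))
      (hα (Φ (h.symm p : W)))
      (mfderiv (𝓡 k) I (Subtype.val : V → W) (h.symm p) (mfderiv (𝓡 k) (𝓡 k) h.symm p u))
      (mfderiv (𝓡 k) I (Subtype.val : V → W) (h.symm p) (mfderiv (𝓡 k) (𝓡 k) h.symm p v))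
    rw [hΦ, OneForm.d_smul, hiso, mul_zero] at key
    have hq : ∀ q, q = Φ (h.symm p : W) → ∀ a b : E, α.d q a b = α.d (Φ (h.symm p : W)) a b := by
      rintro _ rfl a b; rfl
    refine (hq _ hp _ _).trans ?_
    refine Eq.trans ?_ key.symm
    exact congrArg₂ (fun a b : E => α.d (Φ (h.symm p : W)) a b) (hder u) (hder v)
  · intro p
    rw [hval, OneForm.pullback_comp (hdV.comp hdh) hdΦ, hΦ]
    have h1 : OneForm.pullback (𝓡 k) ((Subtype.val : V → W) ∘ h.symm) (fun x => c • α x) p =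
        c • OneForm.pullback (𝓡 k) ((Subtype.val : V → W) ∘ h.symm) α p := rfl
    rw [h1, OneForm.pullback_comp hdh hdV]
    have hdf : MDifferentiableAt (𝓡 k) 𝓘(ℝ, ℝ) f (h.symm p) :=
      (hf.mdifferentiable (by simp)) _
    have h2 : mfderiv (𝓡 k) 𝓘(ℝ, ℝ) (fun y => c * f (h.symm y)) p =
        c • mfderiv (𝓡 k) 𝓘(ℝ, ℝ) (f ∘ h.symm) p :=
      (((hdf.comp p (hdh p)).hasMFDerivAt).const_smul c).mfderiv
    rw [h2, mfderiv_comp p hdf (hdh p), ← hex]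
    rfl

end Transport

/-! ### Outlines and shadows -/

/-- The linear automorphism `(x, y) ↦ (x, c y)` of the plane. -/
noncomputable def stretch (c : ℝ) (hc : c ≠ 0) : (ℝ × ℝ) ≃L[ℝ] (ℝ × ℝ) :=
  (ContinuousLinearEquiv.refl ℝ ℝ).prodCongr (ContinuousLinearEquiv.smulLeft (Units.mk0 c hc))

@[simp]
theorem stretch_apply (c : ℝ) (hc : c ≠ 0) (z : ℝ × ℝ) : stretch c hc z = (z.1, c * z.2) :=
  rfl

theorem volume_image_stretch (c : ℝ) (hc : c ≠ 0) (S : Set (ℝ × ℝ)) :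
    volume (stretch c hc '' S) = ENNReal.ofReal |c| * volume S := by
  rw [Measure.addHaar_image_continuousLinearEquiv]
  change ENNReal.ofReal |LinearMap.det (LinearMap.prodMap (LinearMap.id : ℝ →ₗ[ℝ] ℝ)
    (c • (LinearMap.id : ℝ →ₗ[ℝ] ℝ)))| * _ = _
  rw [LinearMap.det_prodMap]
  simp

theorem isBounded_image_continuousLinearEquiv_iff (A : (ℝ × ℝ) ≃L[ℝ] (ℝ × ℝ)) (C : Set (ℝ × ℝ)) :
    Bornology.IsBounded (A '' C) ↔ Bornology.IsBounded C := by
  refine ⟨fun h => ?_, fun h => A.lipschitz.isBounded_image h⟩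
  have := A.symm.lipschitz.isBounded_image h
  rwa [← Set.image_comp, A.symm_comp_self, Set.image_id] at this

/-- Linear automorphisms of the plane commute with taking the unbounded part of the complement. -/
theorem unboundedPart_image (A : (ℝ × ℝ) ≃L[ℝ] (ℝ × ℝ)) (S : Set (ℝ × ℝ)) :
    unboundedPart (A '' S) = A '' unboundedPart S := by
  have hcomp : (A '' S)ᶜ = A '' Sᶜ := (Set.image_compl_eq A.bijective).symm
  have hC : ∀ z ∈ Sᶜ, connectedComponentIn (A '' S)ᶜ (A z) = A '' connectedComponentIn Sᶜ z := by
    intro z hz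
    rw [hcomp]
    exact (A.toHomeomorph.image_connectedComponentIn hz).symm
  unfold unboundedPart
  rw [Set.image_sUnion]
  congr 1
  ext D
  constructor
  · rintro ⟨w, hw, rfl, hb⟩
    rw [hcomp] at hw
    obtain ⟨z, hz, rfl⟩ := hw
    rw [hC z hz, isBounded_image_continuousLinearEquiv_iff] at hb
    exact ⟨_, ⟨z, hz, rfl, hb⟩, (hC z hz).symm⟩
  · rintro ⟨_, ⟨z, hz, rfl, hb⟩, rfl⟩
    refine ⟨A z, fun h => hz ((A.injective.mem_set_image).1 h), (hC z hz).symm, ?_⟩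
    rwa [isBounded_image_continuousLinearEquiv_iff]

theorem shadow_image_stretch {M N : Type*} (c : ℝ) (hc : c ≠ 0) (ψ : M → N)
    (V : Set ((ℝ × ℝ) × M)) :
    shadow (Prod.map (stretch c hc) ψ '' V) = ENNReal.ofReal |c| * shadow V := by
  have h1 : Prod.fst '' (Prod.map (stretch c hc) ψ '' V) = stretch c hc '' (Prod.fst '' V) := by
    rw [← Set.image_comp, ← Set.image_comp]; rfl
  unfold shadow outline
  rw [h1, unboundedPart_image, ← Set.image_compl_eq (stretch c hc).bijective,
    volume_image_stretch]

/-- A connected unbounded set disjoint from `S` lies in the unbounded part of the complement. -/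
theorem subset_unboundedPart {S T : Set (ℝ × ℝ)} (hT : IsPreconnected T) (hST : T ⊆ Sᶜ)
    (hb : ¬ Bornology.IsBounded T) : T ⊆ unboundedPart S := by
  intro z hz
  refine Set.mem_sUnion.2 ⟨_, ⟨z, hST hz, rfl, fun h => hb (h.subset ?_)⟩,
    mem_connectedComponentIn (hST hz)⟩
  exact hT.subset_connectedComponentIn hz hST

/-- The outline of a set contained in the union of a square and the `x`-axis is contained in this
union too: from any other point a vertical half-line leads to infinity. -/
theorem compl_unboundedPart_subset {S : Set (ℝ × ℝ)} {B : ℝ}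
    (hS : S ⊆ (Set.Icc (-B) B ×ˢ Set.Icc (-B) B) ∪ (Set.univ ×ˢ {0})) :
    (unboundedPart S)ᶜ ⊆ (Set.Icc (-B) B ×ˢ Set.Icc (-B) B) ∪ (Set.univ ×ˢ {0}) := by
  intro z hz
  by_contra hout
  apply hz
  have hz0 : z.2 ≠ 0 := fun h => hout (Or.inr ⟨trivial, h⟩)
  -- the vertical half-line from `z` away from the `x`-axis
  set T : Set (ℝ × ℝ) := (fun s : ℝ => (z.1, z.2 * s)) '' Set.Ici 1 with hTdef
  have hzT : z ∈ T := ⟨1, Set.self_mem_Ici, by simp⟩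
  refine subset_unboundedPart (T := T) ?_ ?_ ?_ hzT
  · exact isPreconnected_Ici.image _ (by fun_prop)
  · rintro _ ⟨s, hs, rfl⟩ hmem
    have hs1 : (1 : ℝ) ≤ s := hs
    have hs0 : 0 < s := by linarith
    rcases hS hmem with h | h
    · refine hout (Or.inl ⟨h.1, ?_⟩)
      have h2 : |z.2 * s| ≤ B := abs_le.2 h.2
      rw [abs_mul, abs_of_pos hs0] at h2
      have : |z.2| ≤ |z.2| * s := le_mul_of_one_le_right (abs_nonneg _) hs1
      exact abs_le.1 (this.trans h2)
    · exact mul_ne_zero hz0 hs0.ne' h.2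
  · intro hb
    obtain ⟨K, hK⟩ := hb.exists_norm_le
    have hpos : 0 < |z.2| := abs_pos.2 hz0
    have hmem : (z.1, z.2 * (1 + |K| / |z.2|)) ∈ T :=
      ⟨1 + |K| / |z.2|, by simp only [Set.mem_Ici, le_add_iff_nonneg_right]; positivity, rfl⟩
    have h1 := (norm_snd_le _).trans (hK _ hmem)
    simp only [Real.norm_eq_abs, abs_mul] at h1
    rw [abs_of_nonneg (by positivity : (0 : ℝ) ≤ 1 + |K| / |z.2|), mul_add,
      mul_div_cancel₀ _ hpos.ne', mul_one] at h1
    linarith [le_abs_self K]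

/-! ### Finiteness of the shadow of a cobordism -/

section Cobordism

variable {n : ℕ} {M : Type*} [TopologicalSpace M]
  [ChartedSpace (EuclideanSpace ℝ (Fin (2 * n))) M]

/-- Outside a compact part, a cobordism projects to the `x`-axis, which has measure zero. -/
theorem IsExactCobordism.shadow_ne_top {lam : OneForm (𝓡 (2 * n)) M} {V : Set ((ℝ × ℝ) × M)}
    {Lpos Lneg : Set M} (hV : IsExactCobordism lam V Lpos Lneg) : shadow V ≠ ⊤ := by
  obtain ⟨R, hR, hneg, hpos, hcpt⟩ := hV.ends
  obtain ⟨K, hK⟩ := (hcpt.image continuous_fst).isBounded.exists_norm_le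
  set B := max R K with hB
  have hsub : Prod.fst '' V ⊆ (Set.Icc (-B) B ×ˢ Set.Icc (-B) B) ∪ (Set.univ ×ˢ {0}) := by
    rintro _ ⟨q, hq, rfl⟩
    by_cases h1 : q.1.1 ≤ -R
    · have : q ∈ V ∩ {q | q.1.1 ≤ -R} := ⟨hq, h1⟩
      rw [hneg] at this
      exact Or.inr ⟨trivial, this.1.2⟩
    by_cases h2 : R ≤ q.1.1
    · have : q ∈ V ∩ {q | R ≤ q.1.1} := ⟨hq, h2⟩
      rw [hpos] at this
      exact Or.inr ⟨trivial, this.1.2⟩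
    have hn : ‖q.1‖ ≤ B := (hK q.1 ⟨q, ⟨⟨⟨⟨(not_le.1 h1).le, (not_le.1 h2).le⟩, trivial⟩,
      trivial⟩, hq⟩, rfl⟩).trans (le_max_right _ _)
    exact Or.inl ⟨abs_le.1 ((norm_fst_le q.1).trans hn), abs_le.1 ((norm_snd_le q.1).trans hn)⟩
  refine ne_top_of_le_ne_top ?_ (measure_mono (compl_unboundedPart_subset hsub))
  refine ne_top_of_le_ne_top ?_ (measure_union_le _ _)
  have h0 : volume ((Set.univ : Set ℝ) ×ˢ ({0} : Set ℝ)) = 0 := by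
    rw [Measure.volume_eq_prod, Measure.prod_prod]; simp
  rw [h0, add_zero]
  exact (isCompact_Icc.prod isCompact_Icc).measure_ne_top

/-! ### The action of the Liouville flow on cobordisms -/

theorem pullback_stretch_planeForm (c : ℝ) (hc : c ≠ 0) :
    OneForm.pullback 𝓘(ℝ, ℝ × ℝ) (stretch c hc) planeForm = fun z => c • planeForm z := by
  funext z
  have h : mfderiv 𝓘(ℝ, ℝ × ℝ) 𝓘(ℝ, ℝ × ℝ) (stretch c hc) z =
      (stretch c hc : (ℝ × ℝ) →L[ℝ] ℝ × ℝ) := by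
    rw [mfderiv_eq_fderiv]
    exact (stretch c hc).fderiv
  simp only [OneForm.pullback]
  rw [h]
  refine ContinuousLinearMap.ext fun (v : ℝ × ℝ) => ?_
  change z.1 * (c * v.2) = c * (z.1 * v.2)
  ring

theorem planeForm_isRegularAt (z : ℝ × ℝ) : planeForm.IsRegularAt z := by
  have h : planeForm.inChart z = fun y => ContinuousAlternatingMap.ofSubsingletonLIE (𝕜 := ℝ)
      (E := ℝ × ℝ) (F := ℝ) (0 : Fin 1) (y.1 • ContinuousLinearMap.snd ℝ ℝ ℝ) := by
    funext y
    ext v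
    rw [OneForm.inChart_apply, modelWithCornersSelf_coe, Set.range_id, mfderivWithin_univ,
      extChartAt_model_space_eq_id]
    exact congrArg (planeForm y) (congrArg (fun T : ℝ × ℝ →L[ℝ] ℝ × ℝ => T (v 0)) mfderiv_id)
  unfold OneForm.IsRegularAt
  rw [h]
  exact (ContinuousAlternatingMap.ofSubsingletonLIE (𝕜 := ℝ) (E := ℝ × ℝ) (F := ℝ)
    (0 : Fin 1)).toContinuousLinearEquiv.differentiableAt.comp _
    (differentiableAt_fst.smul_const _)

theorem stabilize_isRegularAt [IsManifold (𝓡 (2 * n)) ∞ M] {lam : OneForm (𝓡 (2 * n)) M}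
    (hlam : ∀ x, lam.IsRegularAt x) (q : (ℝ × ℝ) × M) : (stabilize lam).IsRegularAt q :=
  ((planeForm_isRegularAt _).pullback contMDiffAt_fst).add ((hlam _).pullback contMDiffAt_snd)

/-- If `ψ^* λ = c λ`, then `(x, y, p) ↦ (x, c y, ψ(p))` multiplies `x dy ⊕ λ` by `c`. -/
theorem pullback_stabilize {lam : OneForm (𝓡 (2 * n)) M} {ψ : M → M} {c : ℝ} (hc : c ≠ 0)
    (hψ : MDifferentiable (𝓡 (2 * n)) (𝓡 (2 * n)) ψ)
    (h : OneForm.pullback (𝓡 (2 * n)) ψ lam = fun x => c • lam x) :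
    OneForm.pullback (𝓘(ℝ, ℝ × ℝ).prod (𝓡 (2 * n))) (Prod.map (stretch c hc) ψ) (stabilize lam) =
      fun q => c • stabilize lam q := by
  have hA : MDifferentiable 𝓘(ℝ, ℝ × ℝ) 𝓘(ℝ, ℝ × ℝ) (stretch c hc) :=
    (stretch c hc).differentiable.mdifferentiable
  have hAψ : MDifferentiable (𝓘(ℝ, ℝ × ℝ).prod (𝓡 (2 * n))) (𝓘(ℝ, ℝ × ℝ).prod (𝓡 (2 * n)))
      (Prod.map (stretch c hc) ψ) := hA.prodMap hψ
  have h1 := OneForm.pullback_comp hAψ (mdifferentiable_fst) planeForm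
  have h2 := OneForm.pullback_comp hAψ (mdifferentiable_snd) lam
  have h3 := OneForm.pullback_comp (mdifferentiable_fst (I := 𝓘(ℝ, ℝ × ℝ)) (I' := 𝓡 (2 * n))
    (M := ℝ × ℝ) (M' := M)) hA planeForm
  have h4 := OneForm.pullback_comp (mdifferentiable_snd (I := 𝓘(ℝ, ℝ × ℝ)) (I' := 𝓡 (2 * n))
    (M := ℝ × ℝ) (M' := M)) hψ lam
  rw [pullback_stretch_planeForm] at h3
  rw [h] at h4
  funext q
  have h13 := congrFun (h1.symm.trans h3) q
  have h24 := congrFun (h2.symm.trans h4) q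
  refine (congrArg₂ (fun S T : (ℝ × ℝ) × EuclideanSpace ℝ (Fin (2 * n)) →L[ℝ] ℝ => S + T)
    h13 h24).trans ?_
  exact (smul_add c (OneForm.pullback (𝓘(ℝ, ℝ × ℝ).prod (𝓡 (2 * n))) Prod.fst planeForm q)
    (OneForm.pullback (𝓘(ℝ, ℝ × ℝ).prod (𝓡 (2 * n))) Prod.snd lam q)).symm

theorem IsClosedExactLagrangian.image [IsManifold (𝓡 (2 * n)) ∞ M] {lam : OneForm (𝓡 (2 * n)) M}
    (hlam : ∀ x, lam.IsRegularAt x) {L : Set M} (hL : IsClosedExactLagrangian lam L)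
    (ψ : M ≃ₘ⟮𝓡 (2 * n), 𝓡 (2 * n)⟯ M) {c : ℝ}
    (h : OneForm.pullback (𝓡 (2 * n)) ψ lam = fun x => c • lam x) :
    IsClosedExactLagrangian lam (ψ '' L) :=
  ⟨hL.1.image ψ.continuous, hL.2.image hlam ψ h⟩

/-- The diffeomorphism `(x, y, p) ↦ (x, c y, ψ(p))` preserves the cylindrical ends, which lie over
the `x`-axis. -/
theorem IsExactCobordism.image [IsManifold (𝓡 (2 * n)) ∞ M] {lam : OneForm (𝓡 (2 * n)) M}
    (hlam : ∀ x, lam.IsRegularAt x) {V : Set ((ℝ × ℝ) × M)} {Lpos Lneg : Set M}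
    (hV : IsExactCobordism lam V Lpos Lneg) (ψ : M ≃ₘ⟮𝓡 (2 * n), 𝓡 (2 * n)⟯ M) {c : ℝ}
    (hc : c ≠ 0) (h : OneForm.pullback (𝓡 (2 * n)) ψ lam = fun x => c • lam x) :
    IsExactCobordism lam (Prod.map (stretch c hc) ψ '' V) (ψ '' Lpos) (ψ '' Lneg) := by
  set Φ : ((ℝ × ℝ) × M) ≃ₘ⟮𝓘(ℝ, ℝ × ℝ).prod (𝓡 (2 * n)), 𝓘(ℝ, ℝ × ℝ).prod (𝓡 (2 * n))⟯
    ((ℝ × ℝ) × M) := (stretch c hc).toDiffeomorph.prodCongr ψ with hΦdef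
  have hΦ : (Φ : (ℝ × ℝ) × M → (ℝ × ℝ) × M) = Prod.map (stretch c hc) ψ := rfl
  refine ⟨?_, ?_⟩
  · rw [← hΦ]
    exact hV.exactLagrangian.image (stabilize_isRegularAt hlam) Φ
      (pullback_stabilize hc (ψ.mdifferentiable (by simp)) h)
  · obtain ⟨R, hR, hneg, hpos, hcpt⟩ := hV.ends
    have hends : ∀ (A : Set ℝ) (L : Set M),
        Prod.map (stretch c hc) ψ '' ((A ×ˢ {(0 : ℝ)}) ×ˢ L) = (A ×ˢ {(0 : ℝ)}) ×ˢ (ψ '' L) := by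
      intro A L
      rw [Set.prodMap_image_prod]
      congr 1
      ext z
      constructor
      · rintro ⟨w, ⟨hw1, hw2⟩, rfl⟩
        exact ⟨hw1, by simp [Set.mem_singleton_iff.1 hw2]⟩
      · rintro ⟨hz1, hz2⟩
        exact ⟨z, ⟨hz1, hz2⟩, Prod.ext rfl (by simp [Set.mem_singleton_iff.1 hz2])⟩
    -- applied below to sets `P` defined by a condition on `x`, which the map does not change
    have hinter : ∀ P : Set ((ℝ × ℝ) × M), (∀ q, Prod.map (stretch c hc) ψ q ∈ P ↔ q ∈ P) →
        (Prod.map (stretch c hc) ψ '' V) ∩ P = Prod.map (stretch c hc) ψ '' (V ∩ P) := by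
      intro P hP
      rw [← Set.image_inter_preimage]
      congr 2
      ext q
      exact hP q
    refine ⟨R, hR, ?_, ?_, ?_⟩
    · rw [hinter _ (fun q => Iff.rfl), hneg, hends]
    · rw [hinter _ (fun q => Iff.rfl), hpos, hends]
    · rw [Set.inter_comm, hinter _ (fun q => by simp), Set.inter_comm]
      exact hcpt.image Φ.continuous

/-- One inequality of the scaling law. Applied to `ψ⁻¹`, which scales `λ` by `c⁻¹`, it gives the
other one. -/
theorem dc_image_le [IsManifold (𝓡 (2 * n)) ∞ M] {lam : OneForm (𝓡 (2 * n)) M}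
    (hlam : ∀ x, lam.IsRegularAt x) (ψ : M ≃ₘ⟮𝓡 (2 * n), 𝓡 (2 * n)⟯ M) {c : ℝ}
    (hc : 0 < c) (h : OneForm.pullback (𝓡 (2 * n)) ψ lam = fun x => c • lam x) (L L' : Set M) :
    dc lam (ψ '' L) (ψ '' L') ≤ ENNReal.ofReal c * dc lam L L' := by
  unfold dc
  rw [sInf_eq_iInf (s := {a | ∃ V, IsExactCobordism lam V L' L ∧ a = shadow V}),
    ENNReal.mul_iInf_of_ne (by simpa using hc) ENNReal.ofReal_ne_top]
  simp_rw [ENNReal.mul_iInf_of_ne (by simpa using hc : ENNReal.ofReal c ≠ 0) ENNReal.ofReal_ne_top]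
  refine le_iInf₂ fun a ha => ?_
  obtain ⟨V, hV, rfl⟩ := ha
  refine sInf_le ⟨_, hV.image hlam ψ hc.ne' h, ?_⟩
  rw [shadow_image_stretch, abs_of_pos hc]

end Cobordism

end LagCob

theorem mainTheorem5 {n : ℕ} {M : Type*} [TopologicalSpace M] [T2Space M]
    [SecondCountableTopology M] [ChartedSpace (EuclideanSpace ℝ (Fin (2 * n))) M]
    [IsManifold (𝓡 (2 * n)) ∞ M]
    (lam : LagCob.OneForm (𝓡 (2 * n)) M) (hlam : LagCob.IsExactSymplectic lam)
    (ψ : ℝ → M → M) (hψ : LagCob.IsLiouvilleFlow lam ψ)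
    (t : ℝ) (L : Set M) (hL : LagCob.IsClosedExactLagrangian lam L)
    (L' : Set M) (hL' : L' ∈ LagCob.cobordantSpace lam L) :
    LagCob.IsClosedExactLagrangian lam (ψ t '' L) ∧
    ψ t '' L' ∈ LagCob.cobordantSpace lam (ψ t '' L) ∧
    LagCob.dc lam L L' ≠ ⊤ ∧
    LagCob.dc lam (ψ t '' L) (ψ t '' L') =
      ENNReal.ofReal (Real.exp t) * LagCob.dc lam L L' := by
  have hreg : ∀ x, lam.IsRegularAt x := fun x => hlam.smooth.isRegularAt x
  obtain ⟨hL'c, V, hV⟩ := hL'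
  have hpb := hψ.pullback_eq hreg
  refine ⟨hL.image hreg (hψ.diffeomorph t) (hpb t),
    ⟨hL'c.image hreg (hψ.diffeomorph t) (hpb t), _,
      hV.image hreg (hψ.diffeomorph t) (Real.exp_pos t).ne' (hpb t)⟩,
    ne_top_of_le_ne_top hV.shadow_ne_top (sInf_le ⟨V, hV, rfl⟩), le_antisymm ?_ ?_⟩
  · exact LagCob.dc_image_le hreg (hψ.diffeomorph t) (Real.exp_pos t) (hpb t) L L'
  · have hinv : ∀ S : Set M, ψ (-t) '' (ψ t '' S) = S := fun S => by
      rw [← Set.image_comp]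
      convert Set.image_id S using 2
      exact (hψ.diffeomorph t).left_inv _
    have h := LagCob.dc_image_le hreg (hψ.diffeomorph (-t)) (Real.exp_pos (-t)) (hpb (-t))
      (ψ t '' L) (ψ t '' L')
    change LagCob.dc lam (ψ (-t) '' (ψ t '' L)) (ψ (-t) '' (ψ t '' L')) ≤ _ at h
    rw [hinv, hinv] at h
    calc _ ≤ ENNReal.ofReal (Real.exp t) * (ENNReal.ofReal (Real.exp (-t)) *
          LagCob.dc lam (ψ t '' L) (ψ t '' L')) := by gcongr
      _ = _ := by
        rw [← mul_assoc, ← ENNReal.ofReal_mul (Real.exp_pos t).le, ← Real.exp_add, add_neg_cancel,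
          Real.exp_zero, ENNReal.ofReal_one, one_mul]
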